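/- Let $M$ be a smooth manifold (finite-dimensional, Hausdorff, second countable, without boundary), let $I\subseteq\mathbb R$ be an open interval (possibly unbounded), let $t_0\in I$, and let $\iota\colon M\to I\times M$ be the smooth inclusion $x\mapsto(t_0,x)$. Let $q\colon F\to I\times M$ be a smooth real vector bundle of finite rank, and let $\iota^!F\to M$ be its pullback along $\iota$, so that $(\iota^!F)_x=F_{(t_0,x)}$. Regard the product manifold $I\times\iota^!F$ as a smooth vector bundle over $I\times M$ whose fibre over $(s,x)$ is $\{s\}\times(\iota^!F)_x\cong F_{(t_0,x)}$. Then $F$ and $I\times\iota^!F$ are isomorphic as smooth vector bundles over the identity of $I\times M$: there is a diffeomorphism $\Theta\colon F\to I\times\iota^!F$ that restricts, for every $(s,x)\in I\times M$, to a linear isomorphism from $F_{(s,x)}$ onto $\{s\}\times(\iota^!F)_x$. -/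

import Mathlib

open Bundle TopologicalSpace
open scoped Manifold ContDiff

/-- The smooth inclusion `ι : M → I × M`, `x ↦ (t₀, x)`, for an open set `I` of the real line
and `t₀ ∈ I`. -/
def sliceInclusion {EM : Type*} [NormedAddCommGroup EM] [NormedSpace ℝ EM]
    {H : Type*} [TopologicalSpace H] (J : ModelWithCorners ℝ EM H)
    (M : Type*) [TopologicalSpace M] [ChartedSpace H M]
    (I : Opens ℝ) (t₀ : I) : C^∞⟮J, M; 𝓘(ℝ, ℝ).prod J, I × M⟯ :=
  ⟨fun x => (t₀, x), contMDiff_const.prodMk contMDiff_id⟩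

/-! ### Transport between fibres through local trivializations. -/

section FiberTransport

open Filter
open scoped Topology

variable {B : Type*} [TopologicalSpace B]
  {F : Type*} [NormedAddCommGroup F] [NormedSpace ℝ F]
  {E : B → Type*} [∀ p, AddCommGroup (E p)] [∀ p, Module ℝ (E p)]
  [∀ p, TopologicalSpace (E p)] [TopologicalSpace (TotalSpace F E)]
  [FiberBundle F E] [VectorBundle ℝ F E]

/-! The base contracts smoothly onto the slice: `exists_contraction_to_slice` moves each point from
its projection to the slice at time 0 to itself at every time at least 1. No connection is used to
lift this path to the fibres. The path is cut at times depending smoothly on the point, so that each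
nontrivial step lies in one trivializing set, and a step carries a vector by keeping its coordinates
in that trivialization (`fiberTransport`). Infinitely many steps are needed globally, but near each
point all but finitely many are identities (`exists_steppingTimes`), so the composite and its
inverse are smooth and fibrewise linear. The inverse is the fibre part of Θ. -/

omit [TopologicalSpace B] [NormedSpace ℝ F] [NormedAddCommGroup F]
  [∀ p, TopologicalSpace (E p)] [TopologicalSpace (TotalSpace F E)]
  [FiberBundle F E] [VectorBundle ℝ F E] in
theorem mk_linearEquiv_cast {p q : B} (hpq : p = q) (v : E p) :
    (⟨q, LinearEquiv.cast (R := ℝ) hpq v⟩ : TotalSpace F E) = ⟨p, v⟩ := by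
  subst hpq
  rfl

/-- The identification of two fibres over the base set of a trivialization, or of two fibres over
equal points. -/
noncomputable def fiberTransport (e : Trivialization F (π F E)) [MemTrivializationAtlas e]
    {p q : B} (h : p = q ∨ p ∈ e.baseSet ∧ q ∈ e.baseSet) : E p ≃ₗ[ℝ] E q :=
  open Classical in
  if hpq : p = q then LinearEquiv.cast hpq
  else (e.linearEquivAt ℝ p (h.resolve_left hpq).1).trans
    (e.linearEquivAt ℝ q (h.resolve_left hpq).2).symm

variable (e : Trivialization F (π F E)) [MemTrivializationAtlas e]

theorem fiberTransport_symm {p q : B} (h : p = q ∨ p ∈ e.baseSet ∧ q ∈ e.baseSet)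
    (h' : q = p ∨ q ∈ e.baseSet ∧ p ∈ e.baseSet) :
    (fiberTransport e h).symm = fiberTransport e h' := by
  by_cases hpq : p = q
  · subst hpq
    ext v
    simp [fiberTransport]
  · rw [fiberTransport, fiberTransport, dif_neg hpq, dif_neg (Ne.symm hpq)]
    rfl

theorem mk_fiberTransport_of_eq {p q : B} (h : p = q ∨ p ∈ e.baseSet ∧ q ∈ e.baseSet)
    (hpq : p = q) (v : E p) :
    (⟨q, fiberTransport e h v⟩ : TotalSpace F E) = ⟨p, v⟩ := by
  subst hpq
  simp [fiberTransport]

/-- Over the base set the coordinate formula also covers `p = q`, so the case split in the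
definition does not break smoothness. -/
theorem fiberTransport_of_mem {p q : B} (h : p = q ∨ p ∈ e.baseSet ∧ q ∈ e.baseSet)
    (hp : p ∈ e.baseSet) (hq : q ∈ e.baseSet) (v : E p) :
    fiberTransport e h v = e.symm q (e ⟨p, v⟩).2 := by
  by_cases hpq : p = q
  · subst hpq
    simp [fiberTransport, hp]
  · simp [fiberTransport, hpq]

/-- The composite of the first `n` transports along a sequence of points of the base. -/
noncomputable def iteratedTransport (e : ℕ → Trivialization F (π F E))
    [∀ n, MemTrivializationAtlas (e n)] (p : ℕ → B)
    (h : ∀ n, p n = p (n + 1) ∨ p n ∈ (e n).baseSet ∧ p (n + 1) ∈ (e n).baseSet) :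
    ∀ n, E (p 0) ≃ₗ[ℝ] E (p n)
  | 0 => LinearEquiv.refl ℝ _
  | n + 1 => (iteratedTransport e p h n).trans (fiberTransport (e n) (h n))

/-- The composite of all transports along an eventually constant sequence of points. -/
noncomputable def limitTransport (e : ℕ → Trivialization F (π F E))
    [∀ n, MemTrivializationAtlas (e n)] (p : ℕ → B)
    (h : ∀ n, p n = p (n + 1) ∨ p n ∈ (e n).baseSet ∧ p (n + 1) ∈ (e n).baseSet)
    {q : B} (hq : ∃ n, ∀ m, n ≤ m → p m = q) : E (p 0) ≃ₗ[ℝ] E q :=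
  (iteratedTransport e p h hq.choose).trans (LinearEquiv.cast (hq.choose_spec _ le_rfl))

section Sequence

variable (e : ℕ → Trivialization F (π F E)) [∀ n, MemTrivializationAtlas (e n)]

theorem mk_iteratedTransport_of_le (p : ℕ → B)
    (h : ∀ n, p n = p (n + 1) ∨ p n ∈ (e n).baseSet ∧ p (n + 1) ∈ (e n).baseSet)
    {q : B} {n m : ℕ} (hnm : n ≤ m) (hn : ∀ k, n ≤ k → p k = q) (v : E (p 0)) :
    (⟨p m, iteratedTransport e p h m v⟩ : TotalSpace F E) =
      ⟨p n, iteratedTransport e p h n v⟩ := by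
  induction m, hnm using Nat.le_induction with
  | base => rfl
  | succ k hk ih =>
    rw [← ih]
    exact mk_fiberTransport_of_eq (e k) (h k)
      ((hn k hk).trans (hn (k + 1) (hk.trans k.le_succ)).symm) _

/-- The chosen stabilization index varies uncontrollably with the point. Any valid index gives the
same vector, so one index can serve a whole neighbourhood. -/
theorem mk_limitTransport (p : ℕ → B)
    (h : ∀ n, p n = p (n + 1) ∨ p n ∈ (e n).baseSet ∧ p (n + 1) ∈ (e n).baseSet)
    {q : B} (hq : ∃ n, ∀ m, n ≤ m → p m = q) {n : ℕ} (hn : ∀ k, n ≤ k → p k = q)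
    (v : E (p 0)) :
    (⟨q, limitTransport e p h hq v⟩ : TotalSpace F E) = ⟨p n, iteratedTransport e p h n v⟩ := by
  rw [limitTransport, LinearEquiv.trans_apply, mk_linearEquiv_cast]
  rcases le_total n hq.choose with hle | hle
  · exact mk_iteratedTransport_of_le e p h hle hn v
  · exact (mk_iteratedTransport_of_le e p h hle hq.choose_spec v).symm

variable {EB : Type*} [NormedAddCommGroup EB] [NormedSpace ℝ EB] {HB : Type*}
  [TopologicalSpace HB] {IB : ModelWithCorners ℝ EB HB} [ChartedSpace HB B]
  [ContMDiffVectorBundle ∞ F E IB]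
  {EZ : Type*} [NormedAddCommGroup EZ] [NormedSpace ℝ EZ] {HZ : Type*}
  [TopologicalSpace HZ] {IZ : ModelWithCorners ℝ EZ HZ} {Z : Type*} [TopologicalSpace Z]
  [ChartedSpace HZ Z]

theorem ContMDiffAt.fiberTransport (e : Trivialization F (π F E)) [MemTrivializationAtlas e]
    {p q : Z → B} {z₀ : Z}
    (h : ∀ z, p z = q z ∨ p z ∈ e.baseSet ∧ q z ∈ e.baseSet)
    (h₀ : p =ᶠ[𝓝 z₀] q ∨ p z₀ ∈ e.baseSet ∧ q z₀ ∈ e.baseSet)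
    (hq : ContMDiffAt IZ IB ∞ q z₀) {v : ∀ z, E (p z)}
    (hv : ContMDiffAt IZ (IB.prod 𝓘(ℝ, F)) ∞ (fun z => (⟨p z, v z⟩ : TotalSpace F E)) z₀) :
    ContMDiffAt IZ (IB.prod 𝓘(ℝ, F)) ∞
      (fun z => (⟨q z, _root_.fiberTransport e (h z) (v z)⟩ : TotalSpace F E)) z₀ := by
  rcases h₀ with h₀ | ⟨hp₀, hq₀⟩
  · refine hv.congr_of_eventuallyEq ?_
    filter_upwards [h₀] with z hz using mk_fiberTransport_of_eq e (h z) hz (v z)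
  · have hp : ContMDiffAt IZ IB ∞ p z₀ := (Bundle.contMDiffAt_totalSpace.1 hv).1
    have hpe := hp.continuousAt.preimage_mem_nhds (e.open_baseSet.mem_nhds hp₀)
    have hqe := hq.continuousAt.preimage_mem_nhds (e.open_baseSet.mem_nhds hq₀)
    refine (e.contMDiffAt_iff (IB := IB) (e.mem_source.2 hq₀)).2 ⟨hq, ?_⟩
    refine ((e.contMDiffAt_iff (IB := IB) (e.mem_source.2 hp₀)).1 hv).2.congr_of_eventuallyEq ?_
    filter_upwards [hpe, hqe] with z hpz hqz
    rw [fiberTransport_of_mem e (h z) hpz hqz, e.apply_mk_symm hqz]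

variable {p : ℕ → Z → B} {z₀ : Z}
  (h : ∀ z n, p n z = p (n + 1) z ∨ p n z ∈ (e n).baseSet ∧ p (n + 1) z ∈ (e n).baseSet)
  (h₀ : ∀ n, p n =ᶠ[𝓝 z₀] p (n + 1) ∨ p n z₀ ∈ (e n).baseSet ∧ p (n + 1) z₀ ∈ (e n).baseSet)

include h₀

theorem ContMDiffAt.iteratedTransport (hp : ∀ n, ContMDiffAt IZ IB ∞ (p n) z₀)
    {v : ∀ z, E (p 0 z)}
    (hv : ContMDiffAt IZ (IB.prod 𝓘(ℝ, F)) ∞ (fun z => (⟨p 0 z, v z⟩ : TotalSpace F E)) z₀)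
    (n : ℕ) :
    ContMDiffAt IZ (IB.prod 𝓘(ℝ, F)) ∞ (fun z =>
      (⟨p n z, _root_.iteratedTransport e (fun n => p n z) (h z) n (v z)⟩ :
        TotalSpace F E)) z₀ := by
  induction n with
  | zero => exact hv
  | succ n ih => exact ContMDiffAt.fiberTransport (e n) (fun z => h z n) (h₀ n) (hp (n + 1)) ih

theorem ContMDiffAt.iteratedTransport_symm (hp : ∀ n, ContMDiffAt IZ IB ∞ (p n) z₀)
    (n : ℕ) {v : ∀ z, E (p n z)}
    (hv : ContMDiffAt IZ (IB.prod 𝓘(ℝ, F)) ∞ (fun z => (⟨p n z, v z⟩ : TotalSpace F E)) z₀) :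
    ContMDiffAt IZ (IB.prod 𝓘(ℝ, F)) ∞ (fun z =>
      (⟨p 0 z, (_root_.iteratedTransport e (fun n => p n z) (h z) n).symm (v z)⟩ :
        TotalSpace F E)) z₀ := by
  induction n with
  | zero => exact hv
  | succ n ih =>
    have h' : ∀ z, p (n + 1) z = p n z ∨
        p (n + 1) z ∈ (e n).baseSet ∧ p n z ∈ (e n).baseSet :=
      fun z => (h z n).imp Eq.symm And.symm
    have key := ih (v := fun z => _root_.fiberTransport (e n) (h' z) (v z))
      (ContMDiffAt.fiberTransport (e n) h' ((h₀ n).imp EventuallyEq.symm And.symm) (hp n) hv)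
    simp only [← fiberTransport_symm (e n) (h _ n)] at key
    exact key

variable {q : Z → B} (hlim : ∀ z, ∃ n, ∀ m, n ≤ m → p m z = q z)
  (hlim₀ : ∃ n, ∀ᶠ z in 𝓝 z₀, ∀ m, n ≤ m → p m z = q z)

include hlim₀

theorem ContMDiffAt.limitTransport (hp : ∀ n, ContMDiffAt IZ IB ∞ (p n) z₀)
    {v : ∀ z, E (p 0 z)}
    (hv : ContMDiffAt IZ (IB.prod 𝓘(ℝ, F)) ∞ (fun z => (⟨p 0 z, v z⟩ : TotalSpace F E)) z₀) :
    ContMDiffAt IZ (IB.prod 𝓘(ℝ, F)) ∞ (fun z =>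
      (⟨q z, _root_.limitTransport e (fun n => p n z) (h z) (hlim z) (v z)⟩ :
        TotalSpace F E)) z₀ := by
  obtain ⟨n, hn⟩ := hlim₀
  refine (ContMDiffAt.iteratedTransport e h h₀ hp hv n).congr_of_eventuallyEq ?_
  filter_upwards [hn] with z hz using mk_limitTransport e _ (h z) (hlim z) hz (v z)

theorem ContMDiffAt.limitTransport_symm (hp : ∀ n, ContMDiffAt IZ IB ∞ (p n) z₀)
    {v : ∀ z, E (q z)}
    (hv : ContMDiffAt IZ (IB.prod 𝓘(ℝ, F)) ∞ (fun z => (⟨q z, v z⟩ : TotalSpace F E)) z₀) :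
    ContMDiffAt IZ (IB.prod 𝓘(ℝ, F)) ∞ (fun z =>
      (⟨p 0 z, (_root_.limitTransport e (fun n => p n z) (h z) (hlim z)).symm (v z)⟩ :
        TotalSpace F E)) z₀ := by
  classical
  obtain ⟨n, hn⟩ := hlim₀
  -- Near `z₀` the vector `w z` is just `v z`, and undoing the first `n` steps from it gives the
  -- claim.
  let w : ∀ z, E (p n z) := fun z =>
    _root_.iteratedTransport e (fun n => p n z) (h z) n
      ((_root_.limitTransport e (fun n => p n z) (h z) (hlim z)).symm (v z))
  have hw : ContMDiffAt IZ (IB.prod 𝓘(ℝ, F)) ∞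
      (fun z => (⟨p n z, w z⟩ : TotalSpace F E)) z₀ := by
    refine hv.congr_of_eventuallyEq ?_
    filter_upwards [hn] with z hz
    rw [← mk_limitTransport e _ (h z) (hlim z) hz, LinearEquiv.apply_symm_apply]
  simpa [w] using ContMDiffAt.iteratedTransport_symm e h h₀ hp n hw

end Sequence

end FiberTransport

/-! ### Smooth subdivision of a homotopy subordinate to an open cover. -/

section SteppingTimes

open Filter Set
open scoped Topology

variable {EN : Type*} [NormedAddCommGroup EN] [NormedSpace ℝ EN] [FiniteDimensional ℝ EN]
  {HN : Type*} [TopologicalSpace HN] {J : ModelWithCorners ℝ EN HN}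
  {N : Type*} [TopologicalSpace N] [ChartedSpace HN N] [IsManifold J ∞ N] [T2Space N]

/-- A nonnegative smooth function on `N × ℝ`, positive at a given point, whose support times stay
inside a given open set when increased by the value of the function. -/
theorem exists_smooth_increment {O : Set (N × ℝ)} (hO : IsOpen O) {z : N × ℝ} (hz : z ∈ O) :
    ∃ β : N × ℝ → ℝ, ContMDiff (J.prod 𝓘(ℝ, ℝ)) 𝓘(ℝ, ℝ) ∞ β ∧ (∀ y, 0 ≤ β y) ∧ 0 < β z ∧
      ∀ y ∈ tsupport β, y ∈ O ∧ (y.1, y.2 + β y) ∈ O := by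
  obtain ⟨x, t⟩ := z
  obtain ⟨U, hU, V, hV, hUV⟩ := mem_nhds_prod_iff.1 (hO.mem_nhds hz)
  obtain ⟨r, hr, hrV⟩ := Metric.mem_nhds_iff.1 hV
  -- Half the radius is left for the increment, which is at most `r / 2`.
  have hW : U ×ˢ Metric.ball t (r / 2) ∈ 𝓝 (x, t) :=
    prod_mem_nhds hU (Metric.ball_mem_nhds t (half_pos hr))
  obtain ⟨f, -, hf⟩ := ((SmoothBumpFunction.nhds_basis_tsupport
    (I := J.prod 𝓘(ℝ, ℝ)) (x, t)).mem_iff).1 hW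
  refine ⟨fun y => r / 2 * f y, contMDiff_const.mul f.contMDiff, fun y => ?_, ?_, ?_⟩
  · exact mul_nonneg (half_pos hr).le f.nonneg
  · simpa [f.eq_one] using hr
  · intro y hy
    obtain ⟨hyU, hyt⟩ := hf (tsupport_mul_subset_right hy)
    have hle : r / 2 * f y ≤ r / 2 := mul_le_of_le_one_right (half_pos hr).le f.le_one
    have hnn : 0 ≤ r / 2 * f y := mul_nonneg (half_pos hr).le f.nonneg
    rw [Metric.mem_ball, Real.dist_eq, abs_lt] at hyt
    refine ⟨hUV ⟨hyU, hrV ?_⟩, hUV ⟨hyU, hrV ?_⟩⟩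
    · rw [Metric.mem_ball, Real.dist_eq, abs_lt]
      constructor <;> linarith
    · rw [Metric.mem_ball, Real.dist_eq, abs_lt]
      constructor <;> dsimp only <;> linarith

/-- Iterating the time shifts by a sequence of functions on `N × ℝ`. -/
def steppingTime (β : ℕ → N × ℝ → ℝ) : ℕ → N → ℝ
  | 0, _ => 0
  | n + 1, x => steppingTime β n x + β n (x, steppingTime β n x)

variable {β : ℕ → N × ℝ → ℝ}

omit [FiniteDimensional ℝ EN] [IsManifold J ∞ N] [T2Space N] in
theorem contMDiff_steppingTime (hβ : ∀ n, ContMDiff (J.prod 𝓘(ℝ, ℝ)) 𝓘(ℝ, ℝ) ∞ (β n)) (n : ℕ) :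
    ContMDiff J 𝓘(ℝ, ℝ) ∞ (steppingTime β n) := by
  induction n with
  | zero => exact contMDiff_const
  | succ n ih => exact ih.add ((hβ n).comp (contMDiff_id.prodMk ih))

omit [TopologicalSpace N] [T2Space N] in
theorem monotone_steppingTime (hβ : ∀ n y, 0 ≤ β n y) (x : N) :
    Monotone fun n => steppingTime β n x :=
  monotone_nat_of_le_succ fun n => le_add_of_nonneg_right (hβ n _)

-- Times bounded by 1 would converge to some `T`, with increments tending to 0; but near `(x, T)`
-- infinitely many increments are at least `c`.
omit [T2Space N] in
theorem exists_one_lt_steppingTime (hβ : ∀ n y, 0 ≤ β n y)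
    (hc : ∀ y : N × ℝ, ∃ c > 0, ∃ U ∈ 𝓝 y, ∃ᶠ n in atTop, ∀ y' ∈ U, c ≤ β n y') (x : N) :
    ∃ n, 1 < steppingTime β n x := by
  by_contra! hle
  have hlim := tendsto_atTop_ciSup (monotone_steppingTime hβ x)
    ⟨1, by rintro _ ⟨n, rfl⟩; exact hle n⟩
  set T := ⨆ n, steppingTime β n x
  obtain ⟨c, hc₀, U, hU, hfreq⟩ := hc (x, T)
  have hmem : ∀ᶠ n in atTop, (x, steppingTime β n x) ∈ U :=
    (tendsto_const_nhds.prodMk_nhds hlim).eventually hU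
  have hdiff : Tendsto (fun n => steppingTime β (n + 1) x - steppingTime β n x) atTop (𝓝 0) := by
    simpa using (hlim.comp (tendsto_add_atTop_nat 1)).sub hlim
  obtain ⟨n, hn, hnU, hnc⟩ :=
    (hfreq.and_eventually (hmem.and (hdiff.eventually (gt_mem_nhds hc₀)))).exists
  have := hn _ hnU
  simp only [steppingTime] at hnc
  linarith

/-- For a homotopy `h` and an open cover of its target there are smooth times `τ n`, starting at
`0` and locally eventually at least `1`, such that `h` at the times `τ n` and `τ (n + 1)` lies in
one set of the cover wherever the two times do not agree locally. -/
theorem exists_steppingTimes [SecondCountableTopology N] [Nonempty N]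
    {B : Type*} [TopologicalSpace B] {h : N × ℝ → B} (hh : Continuous h)
    {O : B → Set B} (hO : ∀ b, IsOpen (O b)) (hmem : ∀ b, b ∈ O b) :
    ∃ (b : ℕ → B) (τ : ℕ → N → ℝ), (∀ n, ContMDiff J 𝓘(ℝ, ℝ) ∞ (τ n)) ∧ (∀ x, τ 0 x = 0) ∧
      (∀ n x, τ n =ᶠ[𝓝 x] τ (n + 1) ∨ h (x, τ n x) ∈ O (b n) ∧ h (x, τ (n + 1) x) ∈ O (b n)) ∧
      ∀ x, ∃ n, ∀ᶠ y in 𝓝 x, ∀ m, n ≤ m → 1 ≤ τ m y := by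
  choose f hf hf₀ hfpos hfO using fun z : N × ℝ =>
    exists_smooth_increment (J := J) ((hO (h z)).preimage hh) (hmem (h z))
  obtain ⟨s, hs, hcover⟩ := TopologicalSpace.countable_cover_nhds (f := fun z => {y | 0 < f z y})
    fun z => (hf z).continuous.continuousAt.eventually (lt_mem_nhds (hfpos z))
  have hsne : s.Nonempty := by
    by_contra hempty
    rw [Set.not_nonempty_iff_eq_empty.1 hempty] at hcover
    simp only [mem_empty_iff_false, iUnion_of_empty, iUnion_empty] at hcover
    exact empty_ne_univ hcover
  obtain ⟨z, rfl⟩ := hs.exists_eq_range hsne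
  -- Unpairing makes every bump recur infinitely often.
  let ζ : ℕ → N × ℝ := fun n => z n.unpair.1
  have hβ₀ : ∀ n y, 0 ≤ f (ζ n) y := fun n => hf₀ _
  have hsmooth : ∀ n, ContMDiff J 𝓘(ℝ, ℝ) ∞ (steppingTime (fun n => f (ζ n)) n) :=
    contMDiff_steppingTime fun n => hf _
  refine ⟨fun n => h (ζ n), steppingTime fun n => f (ζ n), hsmooth, fun _ => rfl, ?_, ?_⟩
  · intro n x
    -- The closed support is needed: off it the increment vanishes on a neighbourhood, not only at
    -- `x`.
    by_cases hx : (x, steppingTime (fun n => f (ζ n)) n x) ∈ tsupport (f (ζ n))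
    · exact Or.inr (hfO _ _ hx)
    · left
      have hcont : Continuous fun y => (y, steppingTime (fun n => f (ζ n)) n y) :=
        continuous_id.prodMk (hsmooth n).continuous
      filter_upwards [hcont.continuousAt.eventually
        ((isClosed_tsupport (f (ζ n))).isOpen_compl.mem_nhds hx)] with y hy
      exact (add_eq_left.2 (image_eq_zero_of_notMem_tsupport hy)).symm
  · intro x
    obtain ⟨n, hn⟩ := exists_one_lt_steppingTime hβ₀ (fun y => by
      obtain ⟨_, ⟨k, rfl⟩, hk⟩ := mem_iUnion₂.1 (hcover.symm ▸ mem_univ y)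
      refine ⟨f (z k) y / 2, half_pos hk, {y' | f (z k) y / 2 < f (z k) y'},
        (hf (z k)).continuous.continuousAt.eventually (lt_mem_nhds (half_lt_self hk)), ?_⟩
      refine frequently_atTop.2 fun m => ⟨Nat.pair k m, Nat.right_le_pair k m, fun y' hy' => ?_⟩
      simpa [ζ] using le_of_lt hy') x
    refine ⟨n, ?_⟩
    filter_upwards [(hsmooth n).continuous.continuousAt.eventually (lt_mem_nhds hn)] with y hy m hm
    exact hy.le.trans (monotone_steppingTime hβ₀ y hm)

end SteppingTimes

/-! ### Contraction of the base onto the slice. -/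

section Slice

variable {EM : Type*} [NormedAddCommGroup EM] [NormedSpace ℝ EM]
  {H : Type*} [TopologicalSpace H] (J : ModelWithCorners ℝ EM H)
  (M : Type*) [TopologicalSpace M] [ChartedSpace H M]
  (I : Opens ℝ) (t₀ : I)

theorem exists_contraction_to_slice (hI : (I : Set ℝ).OrdConnected) :
    ∃ h : (I × M) × ℝ → I × M,
      ContMDiff ((𝓘(ℝ, ℝ).prod J).prod 𝓘(ℝ, ℝ)) (𝓘(ℝ, ℝ).prod J) ∞ h ∧
      (∀ p, h (p, 0) = sliceInclusion J M I t₀ p.2) ∧ ∀ p t, 1 ≤ t → h (p, t) = p := by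
  have hmem : ∀ (s : I) (t : ℝ),
      (t₀ : ℝ) + Real.smoothTransition t * ((s : ℝ) - t₀) ∈ (I : Set ℝ) := fun s t =>
    hI.convex.add_smul_sub_mem t₀.2 s.2
      ⟨Real.smoothTransition.nonneg t, Real.smoothTransition.le_one t⟩
  -- Only the interval coordinate moves, along the segment from `t₀` to `s`; the smooth cutoff makes
  -- the motion stop at time 1.
  refine ⟨fun z => (⟨_, hmem z.1.1 z.2⟩, z.1.2), ?_, fun p => ?_, fun p t ht => ?_⟩
  · refine ContMDiff.prodMk ?_ (contMDiff_snd.comp contMDiff_fst)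
    rw [← ContMDiff.subtypeVal_comp_iff]
    have hs : ContMDiff ((𝓘(ℝ, ℝ).prod J).prod 𝓘(ℝ, ℝ)) 𝓘(ℝ, ℝ) ∞
        fun z : (I × M) × ℝ => (z.1.1 : ℝ) :=
      contMDiff_subtype_val.comp (contMDiff_fst.comp contMDiff_fst)
    have ht : ContMDiff ((𝓘(ℝ, ℝ).prod J).prod 𝓘(ℝ, ℝ)) 𝓘(ℝ, ℝ) ∞
        fun z : (I × M) × ℝ => Real.smoothTransition z.2 :=
      Real.smoothTransition.contDiff.contMDiff.comp contMDiff_snd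
    exact contMDiff_const.add (ht.mul (hs.sub contMDiff_const))
  · refine Prod.ext (Subtype.ext ?_) rfl
    simp [sliceInclusion, Real.smoothTransition.zero]
  · refine Prod.ext (Subtype.ext ?_) rfl
    simp [Real.smoothTransition.one_of_one_le ht]

end Slice

/-! ### Smooth maps into a pullback bundle. -/

section Pullback

variable {B : Type*} [TopologicalSpace B]
  {F : Type*} [NormedAddCommGroup F] [NormedSpace ℝ F]
  {E : B → Type*} [∀ p, AddCommGroup (E p)]
  [∀ p, TopologicalSpace (E p)] [TopologicalSpace (TotalSpace F E)]
  [FiberBundle F E]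
  {EB : Type*} [NormedAddCommGroup EB] [NormedSpace ℝ EB] {HB : Type*}
  [TopologicalSpace HB] {IB : ModelWithCorners ℝ EB HB} [ChartedSpace HB B]
  {EM : Type*} [NormedAddCommGroup EM] [NormedSpace ℝ EM] {HM : Type*}
  [TopologicalSpace HM] {IM : ModelWithCorners ℝ EM HM} {M : Type*} [TopologicalSpace M]
  [ChartedSpace HM M]
  {EZ : Type*} [NormedAddCommGroup EZ] [NormedSpace ℝ EZ] {HZ : Type*}
  [TopologicalSpace HZ] {IZ : ModelWithCorners ℝ EZ HZ} {Z : Type*} [TopologicalSpace Z]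
  [ChartedSpace HZ Z]

/-- A map into the total space of a pullback bundle is smooth iff its projection to the base and
its lift to the original bundle are. -/
theorem contMDiffAt_pullback_totalSpace_iff (f : C^∞⟮IM, M; IB, B⟯) {x : Z → M}
    {v : ∀ z, E (f (x z))} {z₀ : Z} :
    ContMDiffAt IZ (IM.prod 𝓘(ℝ, F)) ∞
        (fun z => (⟨x z, v z⟩ : TotalSpace F (f *ᵖ E))) z₀ ↔
      ContMDiffAt IZ IM ∞ x z₀ ∧
        ContMDiffAt IZ (IB.prod 𝓘(ℝ, F)) ∞
          (fun z => (⟨f (x z), v z⟩ : TotalSpace F E)) z₀ := by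
  rw [Bundle.contMDiffAt_totalSpace, Bundle.contMDiffAt_totalSpace]
  refine ⟨fun h => ⟨h.1, f.contMDiff.contMDiffAt.comp z₀ h.1, h.2⟩, fun h => ⟨h.1, h.2.2⟩⟩

end Pullback

/-! ### Assembly of the isomorphism. -/

theorem corollary4p1
    {EM : Type*} [NormedAddCommGroup EM] [NormedSpace ℝ EM] [FiniteDimensional ℝ EM]
    {H : Type*} [TopologicalSpace H] (J : ModelWithCorners ℝ EM H) [J.Boundaryless]
    (M : Type*) [TopologicalSpace M] [ChartedSpace H M] [IsManifold J ∞ M]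
    [T2Space M] [SecondCountableTopology M]
    (I : Opens ℝ) (hI : (I : Set ℝ).OrdConnected) (t₀ : I)
    (F : Type*) [NormedAddCommGroup F] [NormedSpace ℝ F] [FiniteDimensional ℝ F]
    (E : I × M → Type*) [∀ p, AddCommGroup (E p)] [∀ p, Module ℝ (E p)]
    [∀ p, TopologicalSpace (E p)] [TopologicalSpace (TotalSpace F E)]
    [FiberBundle F E] [VectorBundle ℝ F E]
    [ContMDiffVectorBundle ∞ F E (𝓘(ℝ, ℝ).prod J)] :
    ∃ (Θ : Diffeomorph ((𝓘(ℝ, ℝ).prod J).prod 𝓘(ℝ, F)) (𝓘(ℝ, ℝ).prod (J.prod 𝓘(ℝ, F)))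
          (TotalSpace F E) (I × TotalSpace F ((sliceInclusion J M I t₀) *ᵖ E)) ∞)
      (L : ∀ p : I × M, E p ≃ₗ[ℝ] ((sliceInclusion J M I t₀) *ᵖ E) p.2),
      ∀ (p : I × M) (v : E p), Θ ⟨p, v⟩ = (p.1, ⟨p.2, L p v⟩) := by
  -- Enumerating the bumps by `ℕ` requires a nonempty base.
  rcases isEmpty_or_nonempty (I × M) with hempty | hne
  · exact ⟨⟨⟨fun w => isEmptyElim w.proj, fun w => isEmptyElim (w.1, w.2.proj),
      fun w => isEmptyElim w.proj, fun w => isEmptyElim (w.1, w.2.proj)⟩,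
      fun w => isEmptyElim w.proj, fun w => isEmptyElim (w.1, w.2.proj)⟩,
      fun p => isEmptyElim p, fun p => isEmptyElim p⟩
  obtain ⟨h, hh, hh₀, hh₁⟩ := exists_contraction_to_slice J M I t₀ hI
  obtain ⟨b, τ, hτ, hτ₀, hstep, hlim⟩ := exists_steppingTimes (J := 𝓘(ℝ, ℝ).prod J) hh.continuous
    (O := fun b => (trivializationAt F E b).baseSet)
    (fun b => (trivializationAt F E b).open_baseSet) (mem_baseSet_trivializationAt F E)
  let p : ℕ → I × M → I × M := fun n x => h (x, τ n x)
  have hp : ∀ n, ContMDiff (𝓘(ℝ, ℝ).prod J) (𝓘(ℝ, ℝ).prod J) ∞ (p n) := fun n =>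
    hh.comp (contMDiff_id.prodMk (hτ n))
  let e := fun n => trivializationAt F E (b n)
  have hnhds : ∀ x n, (∀ᶠ y in nhds x, p n y = p (n + 1) y) ∨
      p n x ∈ (e n).baseSet ∧ p (n + 1) x ∈ (e n).baseSet := fun x n =>
    (hstep n x).imp_left fun hx => hx.mono fun y hy => by simp only [p, hy]
  have hpt : ∀ x n, p n x = p (n + 1) x ∨
      p n x ∈ (e n).baseSet ∧ p (n + 1) x ∈ (e n).baseSet := fun x n =>
    (hnhds x n).imp_left fun hx => hx.self_of_nhds
  have hloc : ∀ x, ∃ n, ∀ᶠ y in nhds x, ∀ m, n ≤ m → p m y = y := fun x =>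
    (hlim x).imp fun n hn => hn.mono fun y hy m hm => hh₁ y _ (hy m hm)
  have hev : ∀ x, ∃ n, ∀ m, n ≤ m → p m x = x := fun x =>
    (hloc x).imp fun n hn => hn.self_of_nhds
  have hp₀ : ∀ x, p 0 x = sliceInclusion J M I t₀ x.2 := fun x => by
    simp only [p, hτ₀, hh₀]
  let T : ∀ x, E (p 0 x) ≃ₗ[ℝ] E x := fun x =>
    limitTransport e (fun n => p n x) (hpt x) (hev x)
  let C : ∀ x, E (p 0 x) ≃ₗ[ℝ] E (sliceInclusion J M I t₀ x.2) := fun x =>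
    LinearEquiv.cast (hp₀ x)
  let L : ∀ x : I × M, E x ≃ₗ[ℝ] ((sliceInclusion J M I t₀) *ᵖ E) x.2 := fun x =>
    (T x).symm.trans (C x)
  have hC : ∀ x v, (⟨_, C x v⟩ : TotalSpace F E) = ⟨p 0 x, v⟩ := fun x v =>
    mk_linearEquiv_cast (hp₀ x) v
  have hC_symm : ∀ x v, (⟨p 0 x, (C x).symm v⟩ : TotalSpace F E) = ⟨_, v⟩ := fun x v => by
    rw [← hC, LinearEquiv.apply_symm_apply]
  refine ⟨⟨⟨fun w => (w.proj.1, ⟨w.proj.2, L w.proj w.2⟩),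
    fun u => ⟨(u.1, u.2.proj), (L (u.1, u.2.proj)).symm u.2.2⟩, fun w => ?_, fun u => ?_⟩,
    fun w => ?_, fun u => ?_⟩, L, fun x v => rfl⟩
  · exact congrArg (TotalSpace.mk w.proj) ((L w.proj).symm_apply_apply w.2)
  · exact congrArg (fun v => (u.1, TotalSpace.mk u.2.proj v))
      ((L (u.1, u.2.proj)).apply_symm_apply u.2.2)
  · have hπ := Bundle.contMDiff_proj E (IB := 𝓘(ℝ, ℝ).prod J) (F := F) (n := ∞)
    refine ContMDiffAt.prodMk (contMDiff_fst.comp hπ).contMDiffAt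
      ((contMDiffAt_pullback_totalSpace_iff (IB := 𝓘(ℝ, ℝ).prod J) (sliceInclusion J M I t₀)
        (x := fun w : TotalSpace F E => w.proj.2) (v := fun w => L w.proj w.2)).2
        ⟨(contMDiff_snd.comp hπ).contMDiffAt, ?_⟩)
    have key := ContMDiffAt.limitTransport_symm e (IB := 𝓘(ℝ, ℝ).prod J)
      (IZ := (𝓘(ℝ, ℝ).prod J).prod 𝓘(ℝ, F)) (p := fun n (w : TotalSpace F E) => p n w.proj)
      (q := fun w => w.proj) (z₀ := w) (v := fun w => w.2) (fun w => hpt w.proj)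
      (fun n => (hnhds w.proj n).imp_left hπ.continuous.continuousAt.eventually)
      (fun w => hev w.proj)
      ((hloc w.proj).imp fun n hn => hπ.continuous.continuousAt.eventually hn)
      (fun n => ((hp n).comp hπ).contMDiffAt) contMDiffAt_id
    exact key.congr_of_eventuallyEq (.of_forall fun w => hC w.proj _)
  · have hπ : ContMDiff (𝓘(ℝ, ℝ).prod (J.prod 𝓘(ℝ, F))) (𝓘(ℝ, ℝ).prod J) ∞
        fun u : I × TotalSpace F ((sliceInclusion J M I t₀) *ᵖ E) => (u.1, u.2.proj) :=
      contMDiff_fst.prodMk ((Bundle.contMDiff_proj _).comp contMDiff_snd)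
    refine ContMDiffAt.limitTransport e (IB := 𝓘(ℝ, ℝ).prod J)
      (IZ := 𝓘(ℝ, ℝ).prod (J.prod 𝓘(ℝ, F)))
      (p := fun n (u : I × TotalSpace F ((sliceInclusion J M I t₀) *ᵖ E)) =>
        p n (u.1, u.2.proj))
      (q := fun u => (u.1, u.2.proj)) (z₀ := u) (v := fun u => (C (u.1, u.2.proj)).symm u.2.2)
      (fun u => hpt _) (fun n => (hnhds (u.1, u.2.proj) n).imp_left
        hπ.continuous.continuousAt.eventually)
      (fun u => hev _) ((hloc (u.1, u.2.proj)).imp fun n hn =>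
        hπ.continuous.continuousAt.eventually hn)
      (fun n => ((hp n).comp hπ).contMDiffAt) ?_
    refine ContMDiffAt.congr_of_eventuallyEq ?_ (.of_forall fun u => hC_symm _ _)
    exact ((contMDiffAt_pullback_totalSpace_iff (IB := 𝓘(ℝ, ℝ).prod J) (sliceInclusion J M I t₀)
      (x := fun u : I × TotalSpace F ((sliceInclusion J M I t₀) *ᵖ E) => u.2.proj)
      (v := fun u => u.2.2)).1 contMDiff_snd.contMDiffAt).2
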